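/- All dga's are graded commutative, graded in degrees $n\ge 0$, over a field of characteristic $0$; a filtered dga $(A,d,W)$ carries an increasing multiplicative filtration $W$ by graded subcomplexes with $1\in W_0A$ that is regular (for each $n$ there is $q$ with $W_qA^n=0$) and exhaustive. Put $\mathrm{Dec}W_pA^n=\{x\in W_{p-n}A^n : dx\in W_{p-n-1}A^{n+1}\}$. A *mixed Hodge dga* is a filtered dga $(A,d,W)$ over $\mathbb{Q}$ with a filtration $F$ on $A\otimes_{\mathbb Q}\mathbb{C}$ such that each $(A^n,\mathrm{Dec}W,F)$ is a mixed Hodge structure and the differentials $A^n\to A^{n+1}$ and products $A^n\otimes A^m\to A^{n+m}$ are morphisms of mixed Hodge structures. A *mixed Hodge extension* of $A$ of degree $n$ is a mixed Hodge dga $A\otimes_\xi\Lambda(V)$, where $\Lambda(V)$ is the free graded commutative algebra on a filtered vector space $(V,W)$ of pure degree $n$, $\xi=d|_V:V\to A^{n+1}$ satisfies $d\xi=0$ and $\xi(W_pV)\subset W_{p-1}A$, $V\otimes\mathbb{C}$ has a filtration $F$ compatible with $\xi$ making $(V,\mathrm{Dec}W,F)$ (with $\mathrm{Dec}W_pV=W_{p-n}V$)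 a mixed Hodge structure, and the differential and filtrations on $A\otimes_\xi\Lambda(V)$ are the multiplicative extensions. It is *minimal* if $\xi(V)\subset A^+\cdot A^+$. A mixed Hodge dga is *minimal* if it is the colimit of a sequence of minimal mixed Hodge extensions starting from $\mathbb{Q}$ with its trivial mixed Hodge structure. A *relative minimal mixed Hodge dga* is an inclusion $f:M\hookrightarrow\widetilde M$ of mixed Hodge dga's, where $\widetilde M=M\otimes\Lambda(V)$ is the colimit of a sequence of mixed Hodge extensions starting from $M$ and $$d(W_pV)\subset W_{p-1}(M^+\otimes\Lambda(V))+W_{p-1}(M\otimes\Lambda^{\ge 2}V)\quad\text{for all }p.$$ A *$1$-splitting* of a filtered dga $(A,d,W)$ is a direct sum decomposition $A=\bigoplus_{p,q\in\mathbb{Z}}A^{p,q}$ into subspaces such that $d(A^{p,q})\subset A^{p+1,q}$, $A^{p,q}\cdot A^{p',q'}\subset A^{p+p',q+q'}$ and $W_mA^n=\bigoplus_{p\le m}A^{-p,n+p}$. A morphism $f:A\to B$ of filtered dga's *admits a $1$-splitting* if $A$ and $B$ have $1$-splittings with $f(A^{p,q})\subset B^{p,q}$ for all $p,q$. **Lemma.**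 Let $f:M\hookrightarrow\widetilde M$ be a relative minimal mixed Hodge dga with $M$ minimal, and assume that $M$ and $\widetilde M$ have finite type (each $M^n$ and each $\widetilde M^n$ is finite dimensional). Then the morphism $f:(M,d,W)\to(\widetilde M,d,W)$ of filtered dga's over $\mathbb{Q}$ admits a $1$-splitting over $\mathbb{Q}$. -/

import Mathlib

open scoped TensorProduct

/-! ### Filtered dga's and splittings -/

/-- A filtered commutative dga over a field `k` of characteristic zero, with underlying algebra `A`:
non-negatively graded, graded commutative, with a differential of degree `1` that is a graded
derivation, and an increasing multiplicative filtration `W` by graded subcomplexes which is regular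
and exhaustive. The unit `k → A` is filtered for the trivial filtration of `k` (`one_mem_W`). -/
structure FilteredDGA (k : Type*) [Field k] [CharZero k] (A : Type*) [Ring A] [Algebra k A] where
  /-- `gr n` is the degree `n` part `Aⁿ`. -/
  gr : ℕ → Submodule k A
  /-- The differential. -/
  d : A →ₗ[k] A
  /-- The weight filtration. -/
  W : ℤ → Submodule k A
  isInternal : DirectSum.IsInternal gr
  one_mem : (1 : A) ∈ gr 0
  mul_mem : ∀ {m n : ℕ} {x y : A}, x ∈ gr m → y ∈ gr n → x * y ∈ gr (m + n)
  graded_comm : ∀ {m n : ℕ} {x y : A}, x ∈ gr m → y ∈ gr n → x * y = (-1) ^ (m * n) * (y * x)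
  d_mem : ∀ {n : ℕ} {x : A}, x ∈ gr n → d x ∈ gr (n + 1)
  d_d : ∀ x : A, d (d x) = 0
  leibniz : ∀ {m : ℕ} {x : A} (y : A), x ∈ gr m → d (x * y) = d x * y + (-1) ^ m * (x * d y)
  W_mono : Monotone W
  W_homogeneous : ∀ p : ℤ, W p ≤ ⨆ n : ℕ, W p ⊓ gr n
  one_mem_W : (1 : A) ∈ W 0
  W_mul : ∀ {p q : ℤ} {x y : A}, x ∈ W p → y ∈ W q → x * y ∈ W (p + q)
  W_d : ∀ {p : ℤ} {x : A}, x ∈ W p → d x ∈ W p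
  W_regular : ∀ n : ℕ, ∃ q : ℤ, W q ⊓ gr n = ⊥
  W_exhaustive : ∀ x : A, ∃ p : ℤ, x ∈ W p

namespace FilteredDGA

variable {k : Type*} [Field k] [CharZero k] {A B : Type*} [Ring A] [Algebra k A] [Ring B]
  [Algebra k B]

/-- Deligne's décalage: `Dec W_p Aⁿ = {x ∈ W_{p-n} Aⁿ | d x ∈ W_{p-n-1} Aⁿ⁺¹}`. -/
def decW (X : FilteredDGA k A) (n : ℕ) (p : ℤ) : Submodule k A :=
  X.gr n ⊓ X.W (p - n) ⊓ (X.W (p - n - 1)).comap X.d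

/-- Finite type: every `Aⁿ` is finite dimensional. -/
def FiniteType (X : FilteredDGA k A) : Prop :=
  ∀ n : ℕ, FiniteDimensional k (X.gr n)

/-- The submodules `S p q = A^{p,q}` form an `r`-splitting of the filtered dga `A`. -/
structure IsSplitting (X : FilteredDGA k A) (r : ℕ) (S : ℤ → ℤ → Submodule k A) : Prop where
  isInternal : DirectSum.IsInternal (fun pq : ℤ × ℤ => S pq.1 pq.2)
  d_mem : ∀ {p q : ℤ} {x : A}, x ∈ S p q → X.d x ∈ S (p + r) (q - r + 1)
  mul_mem : ∀ {p q p' q' : ℤ} {x y : A},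
    x ∈ S p q → y ∈ S p' q' → x * y ∈ S (p + p') (q + q')
  W_eq : ∀ (m : ℤ) (n : ℕ), X.W m ⊓ X.gr n = ⨆ p : ℤ, ⨆ _ : p ≤ m, S (-p) (n + p)

/-- `f` admits an `r`-splitting: source and target admit `r`-splittings with which `f` is
compatible. -/
def AdmitsSplitting (X : FilteredDGA k A) (Y : FilteredDGA k B) (f : A →ₐ[k] B) (r : ℕ) : Prop :=
  ∃ (S : ℤ → ℤ → Submodule k A) (T : ℤ → ℤ → Submodule k B),
    X.IsSplitting r S ∧ Y.IsSplitting r T ∧ ∀ p q : ℤ, ∀ x ∈ S p q, f x ∈ T p q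

end FilteredDGA

/-! ### Mixed Hodge structures -/

section MixedHodge

variable {V : Type*} [AddCommGroup V] [Module ℚ V]

/-- Complex conjugation on `ℂ ⊗ V`. -/
noncomputable def complexConj (V : Type*) [AddCommGroup V] [Module ℚ V] :
    ℂ ⊗[ℚ] V →ₗ[ℚ] ℂ ⊗[ℚ] V :=
  LinearMap.rTensor V (Complex.conjAe.toLinearMap.restrictScalars ℚ)

theorem complexConj_smul (c : ℂ) (x : ℂ ⊗[ℚ] V) :
    complexConj V (c • x) = (starRingEnd ℂ c) • complexConj V x := by
  induction x with
  | zero => simp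
  | tmul a v => simp [complexConj, TensorProduct.smul_tmul']
  | add x y hx hy => simp only [smul_add, map_add, hx, hy]

/-- The complex conjugate of a complex subspace of `ℂ ⊗ V`. -/
noncomputable def conjSubmodule (U : Submodule ℂ (ℂ ⊗[ℚ] V)) : Submodule ℂ (ℂ ⊗[ℚ] V) where
  carrier := {x | complexConj V x ∈ U}
  add_mem' := by
    intro a b ha hb
    simp only [Set.mem_ofPred_eq, map_add] at *
    exact U.add_mem ha hb
  zero_mem' := by simp
  smul_mem' := by
    intro c x hx
    simp only [Set.mem_ofPred_eq, complexConj_smul] at *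
    exact U.smul_mem _ hx

/-- `F` is the Hodge filtration of a pure Hodge structure of weight `k` on `V`:
`V_ℂ = F^p ⊕ conj F^{k+1-p}` for all `p`. -/
def IsPureHodge (k : ℤ) (F : ℤ → Submodule ℂ (ℂ ⊗[ℚ] V)) : Prop :=
  ∀ p : ℤ, IsCompl (F p) (conjSubmodule (F (k + 1 - p)))

/-- `Gr_k^W V = W_k / W_{k-1}`. -/
abbrev GrW (W : ℤ → Submodule ℚ V) (k : ℤ) : Type _ :=
  W k ⧸ (W (k - 1)).submoduleOf (W k)

/-- The filtration induced by `F` on `ℂ ⊗ Gr_k^W V`. -/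
noncomputable def grF (W : ℤ → Submodule ℚ V) (F : ℤ → Submodule ℂ (ℂ ⊗[ℚ] V)) (k p : ℤ) :
    Submodule ℂ (ℂ ⊗[ℚ] GrW W k) :=
  ((F p).comap ((W k).subtype.baseChange ℂ)).map
    (((W (k - 1)).submoduleOf (W k)).mkQ.baseChange ℂ)

/-- `(V, W, F)` is a rational mixed Hodge structure. For finite-dimensional `V` this says that `W`
and `F` are finite filtrations and that `F` induces on each `Gr_k^W V` a pure Hodge structure of
weight `k`. -/
structure IsMixedHodge (W : ℤ → Submodule ℚ V) (F : ℤ → Submodule ℂ (ℂ ⊗[ℚ] V)) : Prop where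
  W_mono : Monotone W
  W_regular : ∃ a : ℤ, W a = ⊥
  W_exhaustive : ∀ v : V, ∃ b : ℤ, v ∈ W b
  F_anti : Antitone F
  F_bot : ∃ b : ℤ, F b = ⊥
  F_top : ∃ a : ℤ, F a = ⊤
  pure : ∀ k : ℤ, IsPureHodge k (grF W F k)

/-- The filtrations that `W` and `F` induce on the subspace `U` make it a mixed Hodge structure. -/
def IsMixedHodgeOn (U : Submodule ℚ V) (W : ℤ → Submodule ℚ V)
    (F : ℤ → Submodule ℂ (ℂ ⊗[ℚ] V)) : Prop :=
  IsMixedHodge (fun p => (W p).comap U.subtype) (fun p => (F p).comap (U.subtype.baseChange ℂ))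

end MixedHodge

/-! ### Mixed Hodge dga's -/

/-- A mixed Hodge dga: a filtered dga over `ℚ` with a filtration `F` of `A_ℂ` such that every
`(Aⁿ, Dec W, F)` is a mixed Hodge structure and `d` and the products are morphisms of mixed Hodge
structures. Compatibility of `d` and of the products with `Dec W` is automatic. -/
structure MixedHodgeDGA (A : Type*) [Ring A] [Algebra ℚ A] extends FilteredDGA ℚ A where
  /-- The Hodge filtration. -/
  F : ℤ → Submodule ℂ (ℂ ⊗[ℚ] A)
  F_anti : Antitone F
  F_homogeneous : ∀ p : ℤ, F p ≤ ⨆ n : ℕ, F p ⊓ (gr n).baseChange ℂ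
  one_mem_F : (1 : ℂ ⊗[ℚ] A) ∈ F 0
  F_mul : ∀ {p q : ℤ} {x y : ℂ ⊗[ℚ] A}, x ∈ F p → y ∈ F q → x * y ∈ F (p + q)
  F_d : ∀ {p : ℤ} {x : ℂ ⊗[ℚ] A}, x ∈ F p → d.baseChange ℂ x ∈ F p
  isMixedHodge : ∀ n : ℕ, IsMixedHodgeOn (gr n) (toFilteredDGA.decW n) F

/-! ### Free graded commutative algebras and extensions -/

/-- The relations `x y = (-1)^{n·n} y x` between elements of a vector space `V` of degree `n`. -/
inductive FreeGCARel (k : Type*) [Field k] (n : ℕ) (V : Type*) [AddCommGroup V] [Module k V] :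
    TensorAlgebra k V → TensorAlgebra k V → Prop
  | comm (x y : V) : FreeGCARel k n V (TensorAlgebra.ι k x * TensorAlgebra.ι k y)
      ((-1) ^ (n * n) * (TensorAlgebra.ι k y * TensorAlgebra.ι k x))

/-- The free graded commutative algebra `Λ(V)` on a vector space `V` concentrated in degree `n`
(over a field of characteristic zero): symmetric algebra for `n` even, exterior algebra for `n`
odd. -/
abbrev FreeGCA (k : Type*) [Field k] (n : ℕ) (V : Type*) [AddCommGroup V] [Module k V] : Type _ :=
  RingQuot (FreeGCARel k n V)

/-- For a subspace `E` of `Aⁿ`, the algebra map `Λ(E) → A` extending the inclusion. -/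
noncomputable def FilteredDGA.freeMap {k : Type*} [Field k] [CharZero k] {A : Type*} [Ring A]
    [Algebra k A] (X : FilteredDGA k A) (n : ℕ) (E : Submodule k A) (hE : E ≤ X.gr n) :
    FreeGCA k n E →ₐ[k] A :=
  RingQuot.liftAlgHom k ⟨TensorAlgebra.lift k E.subtype, by
    rintro _ _ ⟨x, y⟩
    simpa using X.graded_comm (hE x.2) (hE y.2)⟩

/-- For a subalgebra `S` of `A` and a subspace `E` of `Aⁿ`, the map `S ⊗ Λ(E) → A`,
`s ⊗ w ↦ s w`. -/
noncomputable def FilteredDGA.extensionMap {k : Type*} [Field k] [CharZero k] {A : Type*} [Ring A]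
    [Algebra k A] (X : FilteredDGA k A) (S : Subalgebra k A) (n : ℕ) (E : Submodule k A)
    (hE : E ≤ X.gr n) : S ⊗[k] FreeGCA k n E →ₗ[k] A :=
  LinearMap.mul' k A ∘ₗ TensorProduct.map S.val.toLinearMap (X.freeMap n E hE).toLinearMap

/-- Multiplicative extension of filtrations: the `p`-th piece is the span of the products
`s e₁ ⋯ e_m` with `s ∈ P q₀`, `e_i ∈ Q q_i` and `q₀ + q₁ + ⋯ + q_m = p`. -/
def multExt {R A : Type*} [CommRing R] [Ring A] [Algebra R A] (P Q : ℤ → Submodule R A) (p : ℤ) :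
    Submodule R A :=
  ⨆ (q : ℤ) (l : List ℤ) (_ : q + l.sum = p), P q * (l.map Q).prod

namespace MixedHodgeDGA

variable {A B : Type*} [Ring A] [Algebra ℚ A] [Ring B] [Algebra ℚ B]

/-- Inside the mixed Hodge dga `A`, the subalgebra `S'` is a mixed Hodge extension `S ⊗_ξ Λ(E)` of
degree `n` of the sub mixed Hodge dga `S`, with `ξ` the restriction of `d` to `E` and with the
filtrations of `S`, `S'` and `E` induced from `A`. On `E`, which has pure degree `n`, one has
`Dec W_p E = W_{p-n} E`. -/
structure IsExtension (X : MixedHodgeDGA A) (S S' : Subalgebra ℚ A) (n : ℕ)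
    (E : Submodule ℚ A) : Prop where
  le_gr : E ≤ X.gr n
  injective : Function.Injective (X.extensionMap S n E le_gr)
  range_eq : LinearMap.range (X.extensionMap S n E le_gr) = Subalgebra.toSubmodule S'
  d_mem : ∀ x ∈ E, X.d x ∈ S
  d_W : ∀ p : ℤ, ∀ x ∈ E, x ∈ X.W p → X.d x ∈ X.W (p - 1)
  isMixedHodge : IsMixedHodgeOn E (fun p => X.W (p - n)) X.F
  W_eq : ∀ p : ℤ, X.W p ⊓ Subalgebra.toSubmodule S' =
    multExt (fun q => X.W q ⊓ Subalgebra.toSubmodule S) (fun q => X.W q ⊓ E) p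
  F_eq : ∀ p : ℤ, X.F p ⊓ (Subalgebra.toSubmodule S').baseChange ℂ =
    multExt (fun q => X.F q ⊓ (Subalgebra.toSubmodule S).baseChange ℂ)
      (fun q => X.F q ⊓ E.baseChange ℂ) p

/-- `A` is the colimit (here: the union) of the sequence `S 0 ⊆ S 1 ⊆ ⋯` in which every
`S (i + 1)` is a mixed Hodge extension `S i ⊗ Λ(E i)` of degree `n i`. -/
structure IsTower (X : MixedHodgeDGA A) (S : ℕ → Subalgebra ℚ A) (n : ℕ → ℕ)
    (E : ℕ → Submodule ℚ A) : Prop where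
  isExtension : ∀ i : ℕ, X.IsExtension (S i) (S (i + 1)) (n i) (E i)
  exhaustive : ∀ x : A, ∃ i : ℕ, x ∈ S i

/-- The ideal `S⁺` of elements of positive degree of a graded subalgebra `S`. -/
def plus (X : MixedHodgeDGA A) (S : Subalgebra ℚ A) : Submodule ℚ A :=
  ⨆ n : ℕ, Subalgebra.toSubmodule S ⊓ X.gr (n + 1)

/-- A minimal mixed Hodge dga: a colimit of minimal mixed Hodge extensions `S i ⊗ Λ(E i)`, that is
`d (E i) ⊆ (S i)⁺ · (S i)⁺`, starting from `ℚ` with its trivial mixed Hodge structure (`ℚ` sits in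
`W₀` and `F⁰`, and meets `W₋₁` and `F¹` in `0`). -/
def IsMinimal (X : MixedHodgeDGA A) : Prop :=
  (1 : A) ∉ X.W (-1) ∧ (1 : ℂ ⊗[ℚ] A) ∉ X.F 1 ∧
    ∃ (S : ℕ → Subalgebra ℚ A) (n : ℕ → ℕ) (E : ℕ → Submodule ℚ A),
      S 0 = ⊥ ∧ X.IsTower S n E ∧
        ∀ i : ℕ, ∀ x ∈ E i, X.d x ∈ X.plus (S i) * X.plus (S i)

/-- `f : M ↪ M̃` is a relative minimal mixed Hodge dga: an inclusion of mixed Hodge dga's (the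
filtrations of `M` being induced from `M̃`) such that `M̃ = M ⊗ Λ(V)`, `V = ⨆ E i`, is a colimit of
mixed Hodge extensions of `M`, with
`d (W_p V) ⊆ W_{p-1} (M⁺ ⊗ Λ(V)) + W_{p-1} (M ⊗ Λ^{≥ 2} V)`. -/
structure IsRelativeMinimal (X : MixedHodgeDGA A) (Y : MixedHodgeDGA B) (f : A →ₐ[ℚ] B) :
    Prop where
  injective : Function.Injective f
  map_gr : ∀ n : ℕ, ∀ x ∈ X.gr n, f x ∈ Y.gr n
  map_d : ∀ x : A, f (X.d x) = Y.d (f x)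
  W_eq : ∀ p : ℤ, X.W p = (Y.W p).comap f.toLinearMap
  F_eq : ∀ p : ℤ, X.F p = (Y.F p).comap (f.toLinearMap.baseChange ℂ)
  exists_tower : ∃ (S : ℕ → Subalgebra ℚ B) (n : ℕ → ℕ) (E : ℕ → Submodule ℚ B),
    S 0 = f.range ∧ Y.IsTower S n E ∧
      ∀ (i : ℕ) (p : ℤ), ∀ x ∈ E i, x ∈ Y.W p →
        Y.d x ∈
          (Y.W (p - 1) ⊓
              Y.plus f.range * Subalgebra.toSubmodule (Algebra.adjoin ℚ (⨆ j, E j : Submodule ℚ B)))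
            ⊔ (Y.W (p - 1) ⊓
              Subalgebra.toSubmodule f.range * ⨆ m : ℕ, (⨆ j, E j) ^ (m + 2))

end MixedHodgeDGA

/-! A 1-splitting is the eigenspace decomposition of a suitable derivation, and such a derivation
can be carried from ℂ down to ℚ.

On the generators of every extension `d` sends `W p` into `W (p - 1)`. This property is
multiplicative, so it holds on all of `M` and `M̃` (`IsTower.W_le_strictW`), and Dec W on degree `n`
is just `W` shifted by `n`. Deligne's bigrading of a mixed Hodge structure is functorial and
multiplicative. The resulting weight grading of the complexified dga is therefore respected by `d`,
by products and by `f`. Equivalently, the operator θ acting by `m` on weight `m` is a derivation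
commuting with `d` and `f` (`IsDeligneOperator`).

θ need not be rational. However, the conditions of being a derivation, commuting with `d`, and
acting by `m` on the `m`-th graded piece are affine in θ. Composing with a ℚ-linear `r : ℂ → ℚ` with
`r 1 = 1` thus gives a rational operator of the same kind (`IsDeligneOperator.isWeightDerivation`).
Its eigenspaces split `W`, because θ - m is invertible on graded pieces of weight other than `m`
(`le_weightSpace_sup`). Placing degree `n` and eigenvalue `m` in bidegree `(n - m, m)` gives the
1-splitting. -/

/-! ### Deligne's splitting for a pair of opposed filtrations -/

section Deligne

variable {K H : Type*} [Ring K] [AddCommGroup H] [Module K H]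

/-- `F` and `G` induce on each graded piece `L k / L (k - 1)` a pair of `k`-opposed filtrations. -/
structure OpposedFiltrations (L F G : ℤ → Submodule K H) : Prop where
  mono : Monotone L
  F_anti : Antitone F
  G_anti : Antitone G
  exists_bot : ∃ a, L a = ⊥
  F_bot : ∀ k, ∃ b, F b ⊓ L k = ⊥
  F_top : ∀ k, ∃ a, L k ≤ F a
  exists_decomp : ∀ (k p : ℤ), ∀ x ∈ L k,
    ∃ u ∈ F p ⊓ L k, ∃ v ∈ G (k + 1 - p) ⊓ L k, x - u - v ∈ L (k - 1)
  mem_of_sub_mem : ∀ (k p : ℤ) (u v : H), u ∈ F p ⊓ L k → v ∈ G (k + 1 - p) ⊓ L k →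
    u - v ∈ L (k - 1) → u ∈ L (k - 1)

/-- The correction term `∑_{i ≥ m} G^{q-i} ∩ L_{k-1-i}` in the definition of Deligne's
bigrading. -/
def deligneTail (L G : ℤ → Submodule K H) (k q m : ℤ) : Submodule K H :=
  ⨆ i : ℕ, G (q - m - i) ⊓ L (k - 1 - m - i)

/-- The piece `I^{p,k-p}` of Deligne's bigrading. -/
def deligneBigrading (L F G : ℤ → Submodule K H) (k p : ℤ) : Submodule K H :=
  F p ⊓ L k ⊓ (G (k - p) ⊓ L k ⊔ deligneTail L G k (k - p) 0)

/-- The piece of weight `k` of Deligne's splitting. -/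
def deligneWeight (L F G : ℤ → Submodule K H) (k : ℤ) : Submodule K H :=
  ⨆ p : ℤ, deligneBigrading L F G k p

theorem inf_le_deligneTail (L G : ℤ → Submodule K H) (k q m : ℤ) (i : ℕ) :
    G (q - m - i) ⊓ L (k - 1 - m - i) ≤ deligneTail L G k q m :=
  le_iSup (fun i : ℕ => G (q - m - i) ⊓ L (k - 1 - m - i)) i

theorem deligneTail_eq_sup (L G : ℤ → Submodule K H) (k q m : ℤ) :
    deligneTail L G k q m = G (q - m) ⊓ L (k - 1 - m) ⊔ deligneTail L G k q (m + 1) := by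
  unfold deligneTail
  rw [← sup_iSup_nat_succ]
  congr 1
  · simp
  · refine iSup_congr fun i => ?_
    congr 2 <;> push_cast <;> ring

namespace OpposedFiltrations

variable {L F G : ℤ → Submodule K H}

theorem deligneTail_le (h : OpposedFiltrations L F G) (k q m : ℤ) :
    deligneTail L G k q m ≤ L (k - 1 - m) :=
  iSup_le fun i => inf_le_right.trans (h.mono (by omega))

theorem deligneBigrading_le (k p : ℤ) : deligneBigrading L F G k p ≤ L k :=
  inf_le_left.trans inf_le_right

theorem deligneWeight_le (k : ℤ) : deligneWeight L F G k ≤ L k :=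
  iSup_le fun _ => deligneBigrading_le _ _

/-- Opposedness in weight `k - 1 - m` pushes `x` one step down: modulo `L (k - 2 - m)` it lies both
in `F p` and in `G (k - p - m)`, hence vanishes. The leading summand then drops as well and is
absorbed by the next tail, as `G` is decreasing. -/
theorem mem_deligneTail (h : OpposedFiltrations L F G) {k p : ℤ} {x : H} (hF : x ∈ F p)
    (hx : x ∈ deligneTail L G k (k - p) 0) (m : ℕ) : x ∈ deligneTail L G k (k - p) m := by
  induction m with
  | zero => simpa using hx
  | succ m ih =>
    have hL := h.deligneTail_le _ _ _ ih
    rw [deligneTail_eq_sup] at ih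
    obtain ⟨y, hy, r, hr, rfl⟩ := Submodule.mem_sup.1 ih
    have hrL := h.deligneTail_le _ _ _ hr
    have e : k - 1 - ((m : ℤ) + 1) = k - 1 - m - 1 := by ring
    have key := h.mem_of_sub_mem (k - 1 - m) p (y + r) y ⟨hF, hL⟩
      ⟨by convert hy.1 using 3; ring, hy.2⟩ (by rw [add_sub_cancel_left, ← e]; exact hrL)
    rw [← e] at key
    have hyL := sub_mem key hrL
    rw [add_sub_cancel_right] at hyL
    have hy' : y ∈ deligneTail L G k (k - p) (m + 1) :=
      inf_le_deligneTail L G k (k - p) (m + 1) 0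
        ⟨h.G_anti (by push_cast; omega) hy.1, by simpa using hyL⟩
    push_cast
    exact add_mem hy' hr

/-- In `L (k - 1)` the leading summand from `G (k - p)` becomes a term of the tail, so
`mem_deligneTail` drives `x` into every lower `L`, and these are eventually zero. -/
theorem eq_zero_of_mem (h : OpposedFiltrations L F G) {k p : ℤ} {x : H}
    (hI : x ∈ deligneBigrading L F G k p) (hL : x ∈ L (k - 1)) : x = 0 := by
  have hx : x ∈ deligneTail L G k (k - p) 0 := by
    obtain ⟨y, hy, r, hr, rfl⟩ := Submodule.mem_sup.1 hI.2
    have hyL := sub_mem hL (by simpa using h.deligneTail_le _ _ _ hr)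
    rw [add_sub_cancel_right] at hyL
    exact add_mem (inf_le_deligneTail L G k (k - p) 0 0
      ⟨by simpa using hy.1, by simpa using hyL⟩) hr
  obtain ⟨a, ha⟩ := h.exists_bot
  have := h.mono (show k - 1 - ((k - 1 - a).toNat : ℤ) ≤ a by omega)
    (h.deligneTail_le _ _ _ (h.mem_deligneTail hI.1.1 hx (k - 1 - a).toNat))
  simpa [ha] using this

/-- Lifts a class of type `(p, k - p)` from the graded piece. The error `x - v` is decomposed weight
by weight: the `F`-parts are subtracted from `x`, while the `G`-parts are exactly the terms the tail
permits. -/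
theorem exists_mem_deligneBigrading (h : OpposedFiltrations L F G) {k p : ℤ} {x v : H}
    (hx : x ∈ F p ⊓ L k) (hv : v ∈ G (k - p) ⊓ L k) (hxv : x - v ∈ L (k - 1)) :
    ∃ e ∈ deligneBigrading L F G k p, x - e ∈ L (k - 1) := by
  have claim : ∀ m : ℕ, ∃ u ∈ F p ⊓ L (k - 1),
      ∃ g ∈ G (k - p) ⊓ L k ⊔ deligneTail L G k (k - p) 0, x - u - g ∈ L (k - 1 - m) := by
    intro m
    induction m with
    | zero =>
      exact ⟨0, zero_mem _, v, Submodule.mem_sup_left hv, by simpa using hxv⟩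
    | succ m ih =>
      obtain ⟨u, hu, g, hg, hl⟩ := ih
      obtain ⟨a, ha, b, hb, hc⟩ := h.exists_decomp _ p _ hl
      refine ⟨u + a, add_mem hu ⟨ha.1, h.mono (by omega) ha.2⟩, g + b,
        add_mem hg (Submodule.mem_sup_right ?_), ?_⟩
      · refine inf_le_deligneTail L G k (k - p) 0 m ⟨?_, ?_⟩
        · convert hb.1 using 3; ring
        · simpa using hb.2
      · convert hc using 1
        · congr 1; push_cast; ring
        · abel
  obtain ⟨a, ha⟩ := h.exists_bot
  obtain ⟨u, hu, g, hg, hl⟩ := claim (k - 1 - a).toNat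
  have h0 := h.mono (show k - 1 - ((k - 1 - a).toNat : ℤ) ≤ a by omega) hl
  rw [ha, Submodule.mem_bot, sub_eq_zero] at h0
  refine ⟨x - u, ⟨⟨sub_mem hx.1 hu.1, sub_mem hx.2 (h.mono (by omega) hu.2)⟩, h0 ▸ hg⟩, ?_⟩
  simpa using hu.2

/-- Induction down the `F`-levels, starting where `F` meets `L k` in zero. Splitting `x` at level `b
- m` leaves a part covered by induction and a remainder of pure type, which lifts to the bigrading.
-/
theorem le_deligneWeight_sup (h : OpposedFiltrations L F G) (k : ℤ) :
    L k ≤ deligneWeight L F G k ⊔ L (k - 1) := by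
  obtain ⟨b, hb⟩ := h.F_bot k
  obtain ⟨a, ha⟩ := h.F_top k
  have claim : ∀ m : ℕ, F (b - m) ⊓ L k ≤ deligneWeight L F G k ⊔ L (k - 1) := by
    intro m
    induction m with
    | zero => simp [hb]
    | succ m ih =>
      intro x hx
      obtain ⟨u, hu, v, hv, hw⟩ := h.exists_decomp k (b - m) x hx.2
      have hxu : x - u ∈ F (b - (m + 1 : ℕ)) ⊓ L k :=
        sub_mem hx ⟨h.F_anti (by push_cast; omega) hu.1, hu.2⟩
      obtain ⟨e, he, hxe⟩ := h.exists_mem_deligneBigrading hxu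
        ⟨by convert hv.1 using 3; push_cast; ring, hv.2⟩ hw
      have := add_mem (add_mem (ih hu) (Submodule.mem_sup_left
        (Submodule.mem_iSup_of_mem _ he))) (Submodule.mem_sup_right hxe)
      convert this using 1
      abel
  exact fun x hx => claim (b - a).toNat ⟨h.F_anti (by omega) (ha hx), hx⟩

theorem disjoint_deligneWeight (h : OpposedFiltrations L F G) (k : ℤ) :
    Disjoint (deligneWeight L F G k) (L (k - 1)) := by
  classical
  rw [Submodule.disjoint_def]
  intro x hx hL
  obtain ⟨e, he, rfl⟩ := (Submodule.mem_iSup_iff_exists_finsupp ..).1 hx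
  rw [Finsupp.sum] at hL ⊢
  generalize e.support = s at hL ⊢
  -- The smallest `p` is peeled off: the other terms lie in `F (p + 1)`, and modulo `L (k - 1)` the
  -- `p`-term lies in `G (k - p)`, which is opposed to it.
  induction s using Finset.induction_on_min with
  | empty => simp
  | insert p s hp ih =>
    have hps : p ∉ s := fun hs => lt_irrefl _ (hp _ hs)
    rw [Finset.sum_insert hps] at hL ⊢
    obtain ⟨v, hv, r, hr, hvr⟩ := Submodule.mem_sup.1 (he p).2
    have hr' : r ∈ L (k - 1) := by simpa using h.deligneTail_le _ _ _ hr
    have hu : ∑ i ∈ s, e i ∈ F (p + 1) ⊓ L k := sum_mem fun i hi =>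
      ⟨h.F_anti (by have := hp i hi; omega) (he i).1.1, (he i).1.2⟩
    have hu' := h.mem_of_sub_mem k (p + 1) _ (-v) hu
      (neg_mem ⟨by convert hv.1 using 3; ring, hv.2⟩) (by
        have := sub_mem hL hr'
        rw [← hvr] at this
        convert this using 1
        abel)
    have he' := sub_mem hL hu'
    rw [add_sub_cancel_right] at he'
    rw [h.eq_zero_of_mem (he p) he', ih hu', add_zero]

end OpposedFiltrations

theorem deligneBigrading_map {H' : Type*} [AddCommGroup H'] [Module K H']
    {L F G : ℤ → Submodule K H} {L' F' G' : ℤ → Submodule K H'} (g : H →ₗ[K] H')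
    (hL : ∀ k, ∀ x ∈ L k, g x ∈ L' k) (hF : ∀ k, ∀ x ∈ F k, g x ∈ F' k)
    (hG : ∀ k, ∀ x ∈ G k, g x ∈ G' k) {k p : ℤ} {x : H}
    (hx : x ∈ deligneBigrading L F G k p) : g x ∈ deligneBigrading L' F' G' k p := by
  refine ⟨⟨hF _ _ hx.1.1, hL _ _ hx.1.2⟩, ?_⟩
  have : G (k - p) ⊓ L k ⊔ deligneTail L G k (k - p) 0 ≤
      (G' (k - p) ⊓ L' k ⊔ deligneTail L' G' k (k - p) 0).comap g := by
    refine sup_le (fun y hy => Submodule.mem_sup_left ⟨hG _ _ hy.1, hL _ _ hy.2⟩)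
      (iSup_le fun i y hy => Submodule.mem_sup_right ?_)
    exact inf_le_deligneTail L' G' k (k - p) 0 i ⟨hG _ _ hy.1, hL _ _ hy.2⟩
  exact this hx.2

theorem deligneWeight_map {H' : Type*} [AddCommGroup H'] [Module K H']
    {L F G : ℤ → Submodule K H} {L' F' G' : ℤ → Submodule K H'} (g : H →ₗ[K] H')
    (hL : ∀ k, ∀ x ∈ L k, g x ∈ L' k) (hF : ∀ k, ∀ x ∈ F k, g x ∈ F' k)
    (hG : ∀ k, ∀ x ∈ G k, g x ∈ G' k) {k : ℤ} {x : H}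
    (hx : x ∈ deligneWeight L F G k) : g x ∈ deligneWeight L' F' G' k := by
  have : deligneWeight L F G k ≤ (deligneWeight L' F' G' k).comap g :=
    iSup_le fun p x hx => Submodule.mem_iSup_of_mem p (deligneBigrading_map g hL hF hG hx)
  exact this hx

end Deligne

/-! ### Multiplicativity of Deligne's splitting. -/

section DeligneMul

variable {K H : Type*} [CommRing K] [Ring H] [Algebra K H]
  {L₁ L₂ L₃ F G : ℤ → Submodule K H}

/-- Three filtrations `L` occur because the factors and the product live in different degrees. A
product of tail terms `i` and `j` falls into tail term `i + j`, with one unit of weight to spare. -/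
theorem deligneBigrading_mul (hL : ∀ k l, ∀ x ∈ L₁ k, ∀ y ∈ L₂ l, x * y ∈ L₃ (k + l))
    (hL₃ : Monotone L₃)
    (hF : ∀ k l, ∀ x ∈ F k, ∀ y ∈ F l, x * y ∈ F (k + l))
    (hG : ∀ k l, ∀ x ∈ G k, ∀ y ∈ G l, x * y ∈ G (k + l))
    {k l p q : ℤ} {x y : H} (hx : x ∈ deligneBigrading L₁ F G k p)
    (hy : y ∈ deligneBigrading L₂ F G l q) :
    x * y ∈ deligneBigrading L₃ F G (k + l) (p + q) := by
  refine ⟨⟨hF _ _ _ hx.1.1 _ hy.1.1, hL _ _ _ hx.1.2 _ hy.1.2⟩, ?_⟩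
  have key := Submodule.mul_mem_mul hx.2 hy.2
  refine (show (_ : Submodule K H) ≤ _ from ?_) key
  have aux : ∀ (a b : ℤ) (i : ℕ), a = k + l - (p + q) - i → b ≤ k + l - 1 - i →
      ∀ z, z ∈ G a → z ∈ L₃ b →
      z ∈ G (k + l - (p + q)) ⊓ L₃ (k + l) ⊔ deligneTail L₃ G (k + l) (k + l - (p + q)) 0 := by
    intro a b i ha hb z hz hz'
    refine Submodule.mem_sup_right (inf_le_deligneTail L₃ G _ _ 0 i ⟨?_, hL₃ (by omega) hz'⟩)
    rw [sub_zero, ← ha]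
    exact hz
  unfold deligneTail
  simp only [Submodule.sup_mul, Submodule.mul_sup, Submodule.iSup_mul, Submodule.mul_iSup]
  refine sup_le (sup_le ?_ (iSup_le fun i => ?_)) (iSup_le fun i => sup_le ?_
    (iSup_le fun j => ?_)) <;> rw [Submodule.mul_le] <;> intro a ha b hb
  · refine Submodule.mem_sup_left ⟨?_, hL _ _ _ ha.2 _ hb.2⟩
    have := hG _ _ _ ha.1 _ hb.1
    rwa [show k - p + (l - q) = k + l - (p + q) by ring] at this
  · exact aux _ _ i (by ring) (by omega) _ (hG _ _ _ ha.1 _ hb.1) (hL _ _ _ ha.2 _ hb.2)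
  · exact aux _ _ i (by ring) (by omega) _ (hG _ _ _ ha.1 _ hb.1) (hL _ _ _ ha.2 _ hb.2)
  · refine aux _ _ (i + j) ?_ ?_ _ (hG _ _ _ ha.1 _ hb.1) (hL _ _ _ ha.2 _ hb.2) <;>
      push_cast
    · ring
    · omega

theorem deligneWeight_mul (hL : ∀ k l, ∀ x ∈ L₁ k, ∀ y ∈ L₂ l, x * y ∈ L₃ (k + l))
    (hL₃ : Monotone L₃)
    (hF : ∀ k l, ∀ x ∈ F k, ∀ y ∈ F l, x * y ∈ F (k + l))
    (hG : ∀ k l, ∀ x ∈ G k, ∀ y ∈ G l, x * y ∈ G (k + l))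
    {k l : ℤ} {x y : H} (hx : x ∈ deligneWeight L₁ F G k)
    (hy : y ∈ deligneWeight L₂ F G l) : x * y ∈ deligneWeight L₃ F G (k + l) := by
  refine (show deligneWeight L₁ F G k * deligneWeight L₂ F G l ≤ _ from ?_)
    (Submodule.mul_mem_mul hx hy)
  simp only [deligneWeight, Submodule.iSup_mul, Submodule.mul_iSup]
  refine iSup_le fun p => iSup_le fun q => Submodule.mul_le.2 fun a ha b hb => ?_
  exact Submodule.mem_iSup_of_mem _ (deligneBigrading_mul hL hL₃ hF hG ‹_› ‹_›)

end DeligneMul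

/-! ### Splittings of filtrations -/

section Splitting

variable {K H : Type*} [Ring K] [AddCommGroup H] [Module K H]

theorem filtration_eq_iSup {L J : ℤ → Submodule K H} (hmono : Monotone L)
    (hle : ∀ k, J k ≤ L k) (hsup : ∀ k, L k ≤ J k ⊔ L (k - 1)) (hbot : ∃ a, L a = ⊥) (k : ℤ) :
    L k = ⨆ j : ℤ, ⨆ _ : j ≤ k, J j := by
  refine le_antisymm ?_ (iSup₂_le fun j hj => (hle j).trans (hmono hj))
  obtain ⟨a, ha⟩ := hbot
  have claim : ∀ m : ℕ, L (a + m) ≤ ⨆ j : ℤ, ⨆ _ : j ≤ a + m, J j := by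
    intro m
    induction m with
    | zero => simp [ha]
    | succ m ih =>
      refine (hsup _).trans (sup_le (le_iSup₂_of_le _ le_rfl le_rfl) ?_)
      rw [show a + ((m + 1 : ℕ) : ℤ) - 1 = a + m by push_cast; ring]
      exact ih.trans (iSup₂_le fun j hj => le_iSup₂_of_le j (by push_cast; omega) le_rfl)
  rcases le_total k a with h | h
  · exact (hmono h).trans (by simp [ha])
  · have := claim (k - a).toNat
    rwa [show a + ((k - a).toNat : ℤ) = k by omega] at this

theorem iSupIndep_of_disjoint_filtration {L J : ℤ → Submodule K H} (hmono : Monotone L)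
    (hle : ∀ k, J k ≤ L k) (hdisj : ∀ k, Disjoint (J k) (L (k - 1))) : iSupIndep J := by
  classical
  rw [iSupIndep_iff_finsetSum_eq_zero_imp_eq_zero]
  intro s v
  induction s using Finset.induction_on_max with
  | empty => simp
  | insert k s hk ih =>
    intro hv h0
    have hks : k ∉ s := fun hs => lt_irrefl _ (hk _ hs)
    rw [Finset.sum_insert hks] at h0
    have hs : ∑ i ∈ s, v i ∈ L (k - 1) := sum_mem fun i hi =>
      hmono (by have := hk i hi; omega) (hle i (hv i (Finset.mem_insert_of_mem hi)))
    have hvk : v k = 0 := Submodule.disjoint_def.1 (hdisj k) _ (hv k (Finset.mem_insert_self _ _))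
      (by rw [eq_neg_of_add_eq_zero_left h0]; exact neg_mem hs)
    rw [hvk, zero_add] at h0
    intro i hi
    rcases Finset.mem_insert.1 hi with rfl | hi
    · exact hvk
    · exact ih (fun j hj => hv j (Finset.mem_insert_of_mem hj)) h0 i hi

theorem iSupIndep_prod {ι κ : Type*} {G : ι → Submodule K H} (J : ι → κ → Submodule K H)
    (hle : ∀ i j, J i j ≤ G i) (hG : iSupIndep G) (hJ : ∀ i, iSupIndep (J i)) :
    iSupIndep (fun x : ι × κ => J x.1 x.2) := by
  classical
  rw [iSupIndep_iff_finsetSum_eq_zero_imp_eq_zero] at hG ⊢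
  intro s v hv h0 x hx
  -- The sum is padded by zeros to a rectangle, so that it can be evaluated row by row.
  let t := s.image Prod.fst ×ˢ s.image Prod.snd
  have hst : s ⊆ t := fun y hy => Finset.mem_product.2
    ⟨Finset.mem_image_of_mem _ hy, Finset.mem_image_of_mem _ hy⟩
  let w : ι × κ → H := fun y => if y ∈ s then v y else 0
  have hw : ∀ y, w y ∈ J y.1 y.2 := fun y => by
    by_cases hy : y ∈ s
    · simpa [w, hy] using hv y hy
    · simp [w, hy]
  have h1 : ∑ y ∈ t, w y = 0 := by
    rw [← h0, ← Finset.sum_subset hst (f := w) (fun y _ hy => by simp [w, hy])]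
    exact Finset.sum_congr rfl fun y hy => by simp [w, hy]
  rw [Finset.sum_product] at h1
  have h2 := hG _ _ (fun i _ => sum_mem fun j _ => hle i j (hw (i, j))) h1 x.1
    (Finset.mem_image_of_mem _ hx)
  have h3 := (iSupIndep_iff_finsetSum_eq_zero_imp_eq_zero _).1 (hJ x.1) _ _
    (fun j _ => hw (x.1, j)) h2 x.2 (Finset.mem_image_of_mem _ hx)
  simpa [w, hx] using h3

end Splitting

/-- A linear map may be prescribed to act by given scalars on the summands of a direct sum. -/
theorem exists_linearMap_smul {K H ι : Type*} [DecidableEq ι] [CommRing K] [AddCommGroup H]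
    [Module K H] (J : ι → Submodule K H) (hJ : DirectSum.IsInternal J) (c : ι → K) :
    ∃ θ : H →ₗ[K] H, ∀ i, ∀ x ∈ J i, θ x = c i • x := by
  let e := LinearEquiv.ofBijective (DirectSum.coeLinearMap J) hJ
  refine ⟨DirectSum.toModule K ι H (fun i => c i • (J i).subtype) ∘ₗ e.symm.toLinearMap,
    fun i x hx => ?_⟩
  have : e.symm x = DirectSum.lof K ι (fun i => J i) i ⟨x, hx⟩ := by
    rw [LinearEquiv.symm_apply_eq]
    exact (DirectSum.coeLinearMap_lof J i ⟨x, hx⟩).symm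
  simp [this]

/-! ### The opposed filtrations of a mixed Hodge structure -/

/-- Moves the structure from a single degree into the ambient algebra, where `d` and products can
compare different degrees. -/
theorem OpposedFiltrations.map_of_injective {K H H' : Type*} [Ring K] [AddCommGroup H]
    [Module K H] [AddCommGroup H'] [Module K H'] {ι : H →ₗ[K] H'} (hι : Function.Injective ι)
    {L : ℤ → Submodule K H} {F' G' : ℤ → Submodule K H'} (hF' : Antitone F') (hG' : Antitone G')
    (h : OpposedFiltrations L (fun p => (F' p).comap ι) (fun p => (G' p).comap ι)) :
    OpposedFiltrations (fun k => (L k).map ι) F' G' where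
  mono _ _ hk := Submodule.map_mono (h.mono hk)
  F_anti := hF'
  G_anti := hG'
  exists_bot := h.exists_bot.imp fun a ha => by simp [ha]
  F_bot k := by
    obtain ⟨b, hb⟩ := h.F_bot k
    refine ⟨b, (Submodule.eq_bot_iff _).2 ?_⟩
    rintro _ ⟨hx, x, hxL, rfl⟩
    have : x ∈ (F' b).comap ι ⊓ L k := ⟨hx, hxL⟩
    rw [hb] at this
    simp [(Submodule.mem_bot K).1 this]
  F_top k := (h.F_top k).imp fun a ha => Submodule.map_le_iff_le_comap.2 ha
  exists_decomp k p := by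
    rintro _ ⟨x, hx, rfl⟩
    obtain ⟨u, hu, v, hv, hw⟩ := h.exists_decomp k p x hx
    exact ⟨ι u, ⟨hu.1, Submodule.mem_map_of_mem hu.2⟩, ι v,
      ⟨hv.1, Submodule.mem_map_of_mem hv.2⟩, x - u - v, hw, by simp⟩
  mem_of_sub_mem k p := by
    rintro _ _ ⟨hu, u, huL, rfl⟩ ⟨hv, v, hvL, rfl⟩ ⟨w, hw, e⟩
    rw [← map_sub] at e
    obtain rfl := hι e
    exact Submodule.mem_map_of_mem (h.mem_of_sub_mem k p u v ⟨hu, huL⟩ ⟨hv, hvL⟩ hw)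

/-! ### Complexification, conjugation and graded quotients. -/

section

variable {V V' : Type*} [AddCommGroup V] [Module ℚ V] [AddCommGroup V'] [Module ℚ V']

theorem complexConj_complexConj (x : ℂ ⊗[ℚ] V) : complexConj V (complexConj V x) = x := by
  induction x with
  | zero => simp
  | tmul a v => simp [complexConj]
  | add x y hx hy => simp only [map_add, hx, hy]

theorem complexConj_baseChange (g : V →ₗ[ℚ] V') (x : ℂ ⊗[ℚ] V) :
    complexConj V' (g.baseChange ℂ x) = g.baseChange ℂ (complexConj V x) := by
  induction x with
  | zero => simp
  | tmul a v => simp [complexConj]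
  | add x y hx hy => simp only [map_add, hx, hy]

theorem mem_conjSubmodule {U : Submodule ℂ (ℂ ⊗[ℚ] V)} {x : ℂ ⊗[ℚ] V} :
    x ∈ conjSubmodule U ↔ complexConj V x ∈ U :=
  Iff.rfl

theorem conjSubmodule_mono {U U' : Submodule ℂ (ℂ ⊗[ℚ] V)} (h : U ≤ U') :
    conjSubmodule U ≤ conjSubmodule U' :=
  fun _ hx => h hx

theorem map_mem_baseChange {S : Submodule ℚ V} {S' : Submodule ℚ V'} {g : V →ₗ[ℚ] V'}
    (h : ∀ x ∈ S, g x ∈ S') {x : ℂ ⊗[ℚ] V} (hx : x ∈ S.baseChange ℂ) :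
    g.baseChange ℂ x ∈ S'.baseChange ℂ := by
  rw [Submodule.baseChange_eq_span] at hx
  refine (Submodule.span_le (p := (S'.baseChange ℂ).comap (g.baseChange ℂ))).2 ?_ hx
  rintro _ ⟨s, hs, rfl⟩
  exact Submodule.tmul_mem_baseChange_of_mem 1 (h s hs)

theorem baseChange_map (S : Submodule ℚ V) (g : V →ₗ[ℚ] V') :
    (S.map g).baseChange ℂ = (S.baseChange ℂ).map (g.baseChange ℂ) := by
  refine le_antisymm ?_ ?_
  · rw [Submodule.baseChange_eq_span, Submodule.span_le]
    rintro _ ⟨_, ⟨s, hs, rfl⟩, rfl⟩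
    exact ⟨1 ⊗ₜ s, Submodule.tmul_mem_baseChange_of_mem 1 hs, by simp⟩
  · rintro _ ⟨x, hx, rfl⟩
    exact map_mem_baseChange (fun x hx => Submodule.mem_map_of_mem hx) hx

theorem baseChange_injective {g : V →ₗ[ℚ] V'} (hg : Function.Injective g) :
    Function.Injective (g.baseChange ℂ) :=
  Module.Flat.lTensor_preserves_injective_linearMap (M := ℂ) g hg

theorem mkQ_baseChange_eq_zero_iff (S : Submodule ℚ V) (x : ℂ ⊗[ℚ] V) :
    S.mkQ.baseChange ℂ x = 0 ↔ x ∈ S.baseChange ℂ :=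
  lTensor_exact ℂ (LinearMap.exact_subtype_mkQ S) (Submodule.mkQ_surjective S) x

theorem subtype_baseChange_mem_iff {W : ℤ → Submodule ℚ V} (hW : Monotone W) (k : ℤ)
    (x : ℂ ⊗[ℚ] W k) : (W k).subtype.baseChange ℂ x ∈ (W (k - 1)).baseChange ℂ ↔
      ((W (k - 1)).submoduleOf (W k)).mkQ.baseChange ℂ x = 0 := by
  rw [mkQ_baseChange_eq_zero_iff]
  have e : W (k - 1) = ((W (k - 1)).submoduleOf (W k)).map (W k).subtype := by
    rw [Submodule.submoduleOf, Submodule.map_comap_subtype, inf_eq_right.2 (hW (by omega))]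
  conv_lhs => rw [e, baseChange_map]
  exact ⟨fun ⟨y, hy, h⟩ => baseChange_injective (W k).injective_subtype h ▸ hy,
    Submodule.mem_map_of_mem⟩

theorem IsMixedHodge.opposedFiltrations {W : ℤ → Submodule ℚ V}
    {F : ℤ → Submodule ℂ (ℂ ⊗[ℚ] V)} (h : IsMixedHodge W F) :
    OpposedFiltrations (fun k => (W k).baseChange ℂ) F (fun q => conjSubmodule (F q)) where
  mono _ _ hk := Submodule.baseChange_mono ℂ (h.W_mono hk)
  F_anti := h.F_anti
  G_anti _ _ hk := conjSubmodule_mono (h.F_anti hk)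
  exists_bot := h.W_regular.imp fun a ha => by simp [ha]
  F_bot _ := h.F_bot.imp fun b hb => by simp [hb]
  F_top _ := h.F_top.imp fun a ha => by simp [ha]
  exists_decomp k p := by
    rintro _ ⟨x, rfl⟩
    obtain ⟨_, ⟨u, hu, rfl⟩, v, ⟨v', hv', hv⟩, e⟩ := Submodule.mem_sup.1
      ((h.pure k p).sup_eq_top.symm ▸ Submodule.mem_top :
        ((W (k - 1)).submoduleOf (W k)).mkQ.baseChange ℂ x ∈ _)
    -- The conjugate of `v` is what lifts to `F`, through `v'`; conjugating `v'` back lifts `v`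
    -- itself.
    refine ⟨_, ⟨hu, LinearMap.mem_range_self _ u⟩, (W k).subtype.baseChange ℂ (complexConj _ v'),
      ⟨?_, LinearMap.mem_range_self _ _⟩, ?_⟩
    · rw [SetLike.mem_coe, mem_conjSubmodule, ← complexConj_baseChange, complexConj_complexConj]
      exact hv'
    · rw [← map_sub, ← map_sub, subtype_baseChange_mem_iff h.W_mono, map_sub, map_sub, ← e,
        ← complexConj_baseChange, hv, complexConj_complexConj]
      abel
  mem_of_sub_mem k p := by
    rintro _ _ ⟨hu, u, rfl⟩ ⟨hv, v, rfl⟩ e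
    rw [← map_sub, subtype_baseChange_mem_iff h.W_mono, map_sub, sub_eq_zero] at e
    rw [subtype_baseChange_mem_iff h.W_mono]
    refine Submodule.disjoint_def.1 (h.pure k p).disjoint _ ⟨u, hu, rfl⟩ ?_
    rw [e, mem_conjSubmodule, complexConj_baseChange]
    refine ⟨complexConj _ v, ?_, rfl⟩
    rw [SetLike.mem_coe, Submodule.mem_comap, ← complexConj_baseChange]
    exact hv

theorem IsMixedHodgeOn.opposedFiltrations {U : Submodule ℚ V} {W : ℤ → Submodule ℚ V}
    {F : ℤ → Submodule ℂ (ℂ ⊗[ℚ] V)} (h : IsMixedHodgeOn U W F) (hWU : ∀ k, W k ≤ U)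
    (hF : Antitone F) :
    OpposedFiltrations (fun k => (W k).baseChange ℂ) F (fun q => conjSubmodule (F q)) := by
  have := OpposedFiltrations.map_of_injective (F' := F) (G' := fun q => conjSubmodule (F q))
    (baseChange_injective U.injective_subtype) hF (fun _ _ hk => conjSubmodule_mono (hF hk))
    (by
      convert IsMixedHodge.opposedFiltrations h using 3 with q
      ext x
      simp [mem_conjSubmodule, complexConj_baseChange])
  convert this using 3 with k
  rw [← baseChange_map, Submodule.map_comap_subtype, inf_eq_right.2 (hWU k)]

end

section

variable {A : Type*} [Ring A] [Algebra ℚ A]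

theorem complexConj_mul (x y : ℂ ⊗[ℚ] A) :
    complexConj A (x * y) = complexConj A x * complexConj A y := by
  induction x with
  | zero => simp
  | add x x' hx hx' => simp only [add_mul, map_add, hx, hx']
  | tmul a v =>
    induction y with
    | zero => simp
    | add y y' hy hy' => simp only [mul_add, map_add, hy, hy']
    | tmul b w => simp [complexConj]

theorem mul_mem_baseChange {S T U : Submodule ℚ A} (h : ∀ s ∈ S, ∀ t ∈ T, s * t ∈ U)
    {x y : ℂ ⊗[ℚ] A} (hx : x ∈ S.baseChange ℂ) (hy : y ∈ T.baseChange ℂ) :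
    x * y ∈ U.baseChange ℂ := by
  rw [Submodule.baseChange_eq_span] at hx hy
  have := Submodule.mul_mem_mul hx hy
  rw [Submodule.span_mul_span] at this
  refine Submodule.span_le.2 ?_ this
  rintro _ ⟨_, ⟨s, hs, rfl⟩, _, ⟨t, ht, rfl⟩, rfl⟩
  simpa using Submodule.tmul_mem_baseChange_of_mem 1 (h s hs t ht)

end

/-! ### Splittings from weight derivations -/

namespace FilteredDGA

variable {k : Type*} [Field k] [CharZero k] {A : Type*} [Ring A] [Algebra k A]

/-- A derivation of the filtered dga `X` commuting with the differential and acting on each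
`W_{m-n} Aⁿ / W_{m-n-1} Aⁿ` as multiplication by `m`. -/
structure IsWeightDerivation (X : FilteredDGA k A) (θ : A →ₗ[k] A) : Prop where
  map_d : ∀ x, θ (X.d x) = X.d (θ x)
  leibniz : ∀ x y, θ (x * y) = θ x * y + x * θ y
  sub_smul_mem : ∀ (n : ℕ) (m : ℤ) (x : A), x ∈ X.gr n ⊓ X.W (m - n) →
    θ x - (m : k) • x ∈ X.gr n ⊓ X.W (m - 1 - n)

/-- The elements of degree `n` on which `θ` acts as multiplication by `m`. -/
def weightSpace (X : FilteredDGA k A) (θ : A →ₗ[k] A) (n : ℕ) (m : ℤ) : Submodule k A :=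
  X.gr n ⊓ Module.End.eigenspace θ (m : k)

/-- The bigrading by `(n - m, m)`, where `n` is the degree and `m` the eigenvalue of `θ`. -/
def weightSplitting (X : FilteredDGA k A) (θ : A →ₗ[k] A) (p q : ℤ) : Submodule k A :=
  if 0 ≤ p + q then X.weightSpace θ (p + q).toNat q else ⊥

variable {X : FilteredDGA k A} {θ : A →ₗ[k] A}

theorem mem_weightSpace {n : ℕ} {m : ℤ} {x : A} :
    x ∈ X.weightSpace θ n m ↔ x ∈ X.gr n ∧ θ x = (m : k) • x := by
  simp [weightSpace]

theorem weightSplitting_eq {p q : ℤ} {n : ℕ} (h : (n : ℤ) = p + q) :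
    X.weightSplitting θ p q = X.weightSpace θ n q := by
  rw [weightSplitting, if_pos (by omega), ← h, Int.toNat_natCast]

theorem eq_zero_or_of_mem_weightSplitting {p q : ℤ} {x : A} (hx : x ∈ X.weightSplitting θ p q) :
    x = 0 ∨ ∃ n : ℕ, (n : ℤ) = p + q ∧ x ∈ X.weightSpace θ n q := by
  by_cases h : 0 ≤ p + q
  · obtain ⟨n, hn⟩ := Int.eq_ofNat_of_zero_le h
    exact Or.inr ⟨n, hn.symm, weightSplitting_eq (X := X) (θ := θ) hn.symm ▸ hx⟩
  · rw [weightSplitting, if_neg h] at hx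
    exact Or.inl ((Submodule.mem_bot k).1 hx)

namespace IsWeightDerivation

/-- For an eigenvector in weight `m + i + 1`, subtracting the graded action leaves `-(i + 1) • x`
one weight lower. In characteristic zero this puts `x` itself there. -/
theorem weightSpace_le (h : X.IsWeightDerivation θ) (n : ℕ) (m : ℤ) :
    X.weightSpace θ n m ≤ X.gr n ⊓ X.W (m - n) := by
  intro x hx
  rw [mem_weightSpace] at hx
  have claim : ∀ i : ℕ, x ∈ X.W (m + i - n) → x ∈ X.W (m - n) := by
    intro i
    induction i with
    | zero => simp
    | succ i ih =>
      intro hi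
      apply ih
      have : _ ∈ X.W _ := (h.sub_smul_mem n _ x ⟨hx.1, hi⟩).2
      rw [hx.2, ← sub_smul] at this
      have hne : (m : k) - ((m + (i + 1 : ℕ) : ℤ) : k) ≠ 0 := by
        push_cast
        rw [sub_add_cancel_left, neg_ne_zero]
        exact_mod_cast i.succ_ne_zero
      rw [Submodule.smul_mem_iff _ hne] at this
      convert this using 2
      push_cast
      ring
  obtain ⟨b, hb⟩ := X.W_exhaustive x
  exact ⟨hx.1, claim (b + n - m).toNat (X.W_mono (by omega) hb)⟩

/-- On the graded piece of weight `j < m`, θ - m is the nonzero scalar `j - m`. Dividing by it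
solves the equation up to lower weight; regularity of `W` ends the recursion. -/
theorem exists_sub_smul_eq (h : X.IsWeightDerivation θ) (n : ℕ) {j m : ℤ} (hj : j < m) {z : A}
    (hz : z ∈ X.gr n ⊓ X.W (j - n)) :
    ∃ y ∈ X.gr n ⊓ X.W (j - n), θ y - (m : k) • y = z := by
  obtain ⟨a, ha⟩ := X.W_regular n
  have claim : ∀ i : ℕ, ∀ j : ℤ, j - n = a + i → j < m → ∀ z ∈ X.gr n ⊓ X.W (j - n),
      ∃ y ∈ X.gr n ⊓ X.W (j - n), θ y - (m : k) • y = z := by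
    intro i
    induction i with
    | zero =>
      intro j hj _ z hz
      rw [hj, Nat.cast_zero, add_zero, inf_comm, ha, Submodule.mem_bot] at hz
      exact ⟨0, zero_mem _, by simp [hz]⟩
    | succ i ih =>
      intro j hj hjm z hz
      have hne : (j : k) - (m : k) ≠ 0 := by
        rw [sub_ne_zero]
        exact_mod_cast hjm.ne
      have hy₀ := (X.gr n ⊓ X.W (j - n)).smul_mem ((j : k) - (m : k))⁻¹ hz
      obtain ⟨y₁, hy₁, e⟩ := ih (j - 1) (by push_cast at hj; omega) (by omega) _
        (h.sub_smul_mem n j _ hy₀)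
      refine ⟨_, sub_mem hy₀ ⟨hy₁.1, X.W_mono (by omega) hy₁.2⟩, ?_⟩
      have e₂ : (j : k) • ((j : k) - (m : k))⁻¹ • z - (m : k) • ((j : k) - (m : k))⁻¹ • z = z := by
        rw [← sub_smul, smul_smul, mul_inv_cancel₀ hne, one_smul]
      rw [map_sub, smul_sub, sub_sub_sub_comm, e, sub_sub_sub_cancel_left]
      exact e₂
  rcases le_total (j - n) a with hja | hja
  · have : z ∈ X.W a ⊓ X.gr n := ⟨X.W_mono hja hz.2, hz.1⟩
    rw [ha, Submodule.mem_bot] at this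
    exact ⟨0, zero_mem _, by simp [this]⟩
  · exact claim (j - n - a).toNat j (by omega) hj z hz

/-- (θ - m) x has lower weight, hence equals (θ - m) y with `y` of lower weight; then `x - y` is an
eigenvector. -/
theorem le_weightSpace_sup (h : X.IsWeightDerivation θ) (n : ℕ) (m : ℤ) :
    X.gr n ⊓ X.W (m - n) ≤ X.weightSpace θ n m ⊔ X.gr n ⊓ X.W (m - 1 - n) := by
  intro x hx
  obtain ⟨y, hy, e⟩ := h.exists_sub_smul_eq n (show m - 1 < m by omega) (h.sub_smul_mem n m x hx)
  refine Submodule.mem_sup.2 ⟨x - y, mem_weightSpace.2 ⟨sub_mem hx.1 hy.1, ?_⟩, y, hy, by abel⟩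
  rw [map_sub, smul_sub, sub_eq_sub_iff_sub_eq_sub, e]

theorem W_inf_gr_eq (h : X.IsWeightDerivation θ) (m : ℤ) (n : ℕ) :
    X.W m ⊓ X.gr n = ⨆ p : ℤ, ⨆ _ : p ≤ m, X.weightSplitting θ (-p) (n + p) := by
  have key := filtration_eq_iSup (L := fun j => X.gr n ⊓ X.W (j - n)) (J := X.weightSpace θ n)
    (fun _ _ hij => inf_le_inf_left _ (X.W_mono (by omega))) (h.weightSpace_le n)
    (h.le_weightSpace_sup n)
    (by
      obtain ⟨a, ha⟩ := X.W_regular n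
      exact ⟨a + n, by simpa [inf_comm] using ha⟩) (m + n)
  rw [add_sub_cancel_right, inf_comm] at key
  have e (p : ℤ) : X.weightSplitting θ (-p) (n + p) = X.weightSpace θ n (n + p) :=
    weightSplitting_eq (by ring)
  rw [key]
  simp only [e]
  refine le_antisymm (iSup₂_le fun j hj => ?_) (iSup₂_le fun p hp => ?_)
  · refine le_iSup₂_of_le (j - n) (by omega) ?_
    rw [add_sub_cancel]
  · exact le_iSup₂_of_le (f := fun j (_ : j ≤ m + n) => X.weightSpace θ n j) (n + p) (by omega)
      le_rfl

theorem isInternal (h : X.IsWeightDerivation θ) :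
    DirectSum.IsInternal (fun pq : ℤ × ℤ => X.weightSplitting θ pq.1 pq.2) := by
  refine DirectSum.isInternal_submodule_of_iSupIndep_of_iSup_eq_top ?_ ?_
  -- Pieces with `p + q < 0` vanish; without them, `(p, q) ↦ (p + q, q)` is injective into degree
  -- and eigenvalue.
  · rw [← iSupIndep_ne_bot]
    have hnonneg (x : {x : ℤ × ℤ // X.weightSplitting θ x.1 x.2 ≠ ⊥}) :
        0 ≤ x.1.1 + x.1.2 := by
      by_contra hlt
      exact x.2 (if_neg hlt)
    have hind := iSupIndep_prod (X.weightSpace θ) (fun _ _ => inf_le_left)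
      X.isInternal.submodule_iSupIndep (fun n => ((Module.End.eigenspaces_iSupIndep θ).comp
        (f := fun m : ℤ => (m : k)) Int.cast_injective).mono fun m => inf_le_right)
    convert hind.comp (f := fun x : {x : ℤ × ℤ // X.weightSplitting θ x.1 x.2 ≠ ⊥} =>
      ((x.1.1 + x.1.2).toNat, x.1.2)) ?_ using 1
    · funext x
      exact if_pos (hnonneg x)
    · intro x y hxy
      have hx := hnonneg x
      have hy := hnonneg y
      simp only [Prod.mk.injEq] at hxy
      exact Subtype.ext (Prod.ext (by omega) hxy.2)
  · rw [eq_top_iff, ← X.isInternal.submodule_iSup_eq_top]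
    refine iSup_le fun n x hx => ?_
    obtain ⟨m, hm⟩ := X.W_exhaustive x
    have hx' : x ∈ X.W m ⊓ X.gr n := ⟨hm, hx⟩
    rw [h.W_inf_gr_eq] at hx'
    exact (iSup₂_le fun p _ => le_iSup (fun pq : ℤ × ℤ => X.weightSplitting θ pq.1 pq.2)
      (-p, (n : ℤ) + p)) hx'

theorem isSplitting (h : X.IsWeightDerivation θ) : X.IsSplitting 1 (X.weightSplitting θ) where
  isInternal := h.isInternal
  d_mem {p q x} hx := by
    obtain rfl | ⟨n, hn, hx⟩ := eq_zero_or_of_mem_weightSplitting hx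
    · simp
    · rw [mem_weightSpace] at hx
      rw [weightSplitting_eq (n := n + 1) (by push_cast; omega), mem_weightSpace]
      refine ⟨X.d_mem hx.1, ?_⟩
      rw [h.map_d, hx.2, map_smul]
      simp
  mul_mem {p q p' q' x y} hx hy := by
    obtain rfl | ⟨n, hn, hx⟩ := eq_zero_or_of_mem_weightSplitting hx
    · simp
    obtain rfl | ⟨n', hn', hy⟩ := eq_zero_or_of_mem_weightSplitting hy
    · simp
    rw [mem_weightSpace] at hx hy
    rw [weightSplitting_eq (n := n + n') (by push_cast; omega), mem_weightSpace]
    refine ⟨X.mul_mem hx.1 hy.1, ?_⟩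
    rw [h.leibniz, hx.2, hy.2, smul_mul_assoc, mul_smul_comm, ← add_smul]
    push_cast
    rfl
  W_eq := h.W_inf_gr_eq

end IsWeightDerivation

theorem admitsSplitting_one_of_isWeightDerivation {B : Type*} [Ring B] [Algebra k B]
    {Y : FilteredDGA k B} {η : B →ₗ[k] B} {f : A →ₐ[k] B} (hθ : X.IsWeightDerivation θ)
    (hη : Y.IsWeightDerivation η) (hgr : ∀ n, ∀ x ∈ X.gr n, f x ∈ Y.gr n)
    (hf : ∀ x, f (θ x) = η (f x)) : X.AdmitsSplitting Y f 1 := by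
  refine ⟨_, _, hθ.isSplitting, hη.isSplitting, fun p q x hx => ?_⟩
  obtain rfl | ⟨n, hn, hx⟩ := eq_zero_or_of_mem_weightSplitting hx
  · simp
  · rw [mem_weightSpace] at hx
    rw [weightSplitting_eq hn, mem_weightSpace]
    exact ⟨hgr n x hx.1, by rw [← hf, hx.2, map_smul]⟩

end FilteredDGA

/-! ### The differential lowers the weight filtration -/

theorem neg_one_pow_mul_mem_iff {K A : Type*} [CommRing K] [Ring A] [Algebra K A]
    (S : Submodule K A) (m : ℕ) (x : A) : (-1) ^ m * x ∈ S ↔ x ∈ S := by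
  rcases neg_one_pow_eq_or A m with h | h <;> simp [h]

namespace FilteredDGA

variable {k : Type*} [Field k] [CharZero k] {A : Type*} [Ring A] [Algebra k A]

theorem d_one (X : FilteredDGA k A) : X.d 1 = 0 := by
  simpa using X.leibniz 1 X.one_mem

/-- The elements `x` of `W p` with `d x ∈ W (p - 1)`. -/
def strictW (X : FilteredDGA k A) (p : ℤ) : Submodule k A :=
  X.W p ⊓ (X.W (p - 1)).comap X.d

variable {X : FilteredDGA k A}

theorem one_mem_strictW : (1 : A) ∈ X.strictW 0 :=
  ⟨X.one_mem_W, by simp [X.d_one]⟩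

/-- The Leibniz rule requires a homogeneous left factor, so `x` is split into components, each still
in `W p`. -/
theorem d_mul_sub_mem {p q : ℤ} {x y : A} (hx : x ∈ X.W p) (hy : X.d y ∈ X.W q) :
    X.d (x * y) - X.d x * y ∈ X.W (p + q) := by
  refine Submodule.iSup_induction _ (motive := fun x => X.d (x * y) - X.d x * y ∈ X.W (p + q))
    (X.W_homogeneous p hx) (fun n x hx => ?_) (by simp) (fun x x' h h' => ?_)
  · rw [X.leibniz y hx.2, add_sub_cancel_left, neg_one_pow_mul_mem_iff]
    exact X.W_mul hx.1 hy
  · convert add_mem h h' using 1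
    simp only [add_mul, map_add]
    abel

theorem mul_mem_strictW {p q : ℤ} {x y : A} (hx : x ∈ X.strictW p) (hy : y ∈ X.strictW q) :
    x * y ∈ X.strictW (p + q) := by
  refine ⟨X.W_mul hx.1 hy.1, ?_⟩
  have h := add_mem (d_mul_sub_mem hx.1 hy.2) (X.W_mono (show p - 1 + q ≤ p + (q - 1) by omega)
    (X.W_mul hx.2 hy.1))
  rw [sub_add_cancel, ← add_sub_assoc] at h
  exact h

theorem strictW_mul_le (p q : ℤ) : X.strictW p * X.strictW q ≤ X.strictW (p + q) :=
  Submodule.mul_le.2 fun _ hx _ hy => mul_mem_strictW hx hy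

theorem multExt_le_strictW {P Q : ℤ → Submodule k A} (hP : ∀ p, P p ≤ X.strictW p)
    (hQ : ∀ p, Q p ≤ X.strictW p) (p : ℤ) : multExt P Q p ≤ X.strictW p := by
  have hl (l : List ℤ) : (l.map Q).prod ≤ X.strictW l.sum := by
    induction l with
    | nil => simpa [Submodule.one_le] using one_mem_strictW
    | cons q l ih =>
      simpa using (mul_le_mul' (hQ q) ih).trans (strictW_mul_le _ _)
  refine iSup_le fun q => iSup₂_le fun l hql => ?_
  exact ((mul_le_mul' (hP q) (hl l)).trans (strictW_mul_le _ _)).trans_eq (by rw [hql])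

theorem decW_eq_of_W_le_strictW (h : ∀ p, X.W p ≤ X.strictW p) (n : ℕ) (p : ℤ) :
    X.decW n p = X.gr n ⊓ X.W (p - n) :=
  inf_eq_left.2 (inf_le_right.trans ((h _).trans inf_le_right))

end FilteredDGA

namespace MixedHodgeDGA

variable {A B : Type*} [Ring A] [Algebra ℚ A] [Ring B] [Algebra ℚ B]

/-- Each stage carries the multiplicative extension of `W` from the previous stage and the new
generators, on which `d` lowers weight by `d_W`. -/
theorem IsTower.W_le_strictW {X : MixedHodgeDGA A} {S : ℕ → Subalgebra ℚ A} {n : ℕ → ℕ}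
    {E : ℕ → Submodule ℚ A} (h : X.IsTower S n E)
    (h0 : ∀ p, X.W p ⊓ Subalgebra.toSubmodule (S 0) ≤ X.strictW p) (p : ℤ) :
    X.W p ≤ X.strictW p := by
  have hS : ∀ i p, X.W p ⊓ Subalgebra.toSubmodule (S i) ≤ X.strictW p := by
    intro i
    induction i with
    | zero => exact h0
    | succ i ih =>
      intro p
      rw [(h.isExtension i).W_eq p]
      exact FilteredDGA.multExt_le_strictW (Q := fun q => X.W q ⊓ E i) ih
        (fun q x ⟨hx, hxE⟩ => ⟨hx, (h.isExtension i).d_W q x hxE hx⟩) p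
  intro x hx
  obtain ⟨i, hi⟩ := h.exhaustive x
  exact hS i p ⟨hx, hi⟩

theorem IsMinimal.W_le_strictW {X : MixedHodgeDGA A} (h : X.IsMinimal) (p : ℤ) :
    X.W p ≤ X.strictW p := by
  obtain ⟨-, -, S, n, E, hS0, hT, -⟩ := h
  refine hT.W_le_strictW (fun p => ?_) p
  rintro x ⟨hx, hx0⟩
  rw [hS0] at hx0
  obtain ⟨c, rfl⟩ := Algebra.mem_bot.1 hx0
  refine ⟨hx, ?_⟩
  simp [Algebra.algebraMap_eq_smul_one, X.d_one]

theorem IsRelativeMinimal.W_le_strictW {X : MixedHodgeDGA A} {Y : MixedHodgeDGA B}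
    {f : A →ₐ[ℚ] B} (h : X.IsRelativeMinimal Y f) (hX : ∀ p, X.W p ≤ X.strictW p) (p : ℤ) :
    Y.W p ≤ Y.strictW p := by
  obtain ⟨S, n, E, hS0, hT, -⟩ := h.exists_tower
  refine hT.W_le_strictW (fun p => ?_) p
  rintro x ⟨hx, hx0⟩
  rw [hS0] at hx0
  obtain ⟨a, rfl⟩ := hx0
  have ha : a ∈ X.W p := by
    rw [h.W_eq]
    exact hx
  have hda := (hX p ha).2
  rw [SetLike.mem_coe, Submodule.mem_comap, h.W_eq] at hda
  refine ⟨hx, ?_⟩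
  change Y.d (f a) ∈ Y.W (p - 1)
  rw [← h.map_d]
  exact hda

/-! ### The weight derivation -/

/-- The piece of weight `m` of Deligne's splitting of the mixed Hodge structure on `Aⁿ`. -/
noncomputable def deligne (X : MixedHodgeDGA A) (n : ℕ) (m : ℤ) : Submodule ℂ (ℂ ⊗[ℚ] A) :=
  deligneWeight (fun j => (X.decW n j).baseChange ℂ) X.F (fun q => conjSubmodule (X.F q)) m

theorem opposedFiltrations (X : MixedHodgeDGA A) (n : ℕ) :
    OpposedFiltrations (fun j => (X.decW n j).baseChange ℂ) X.F
      (fun q => conjSubmodule (X.F q)) :=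
  (X.isMixedHodge n).opposedFiltrations (fun _ => inf_le_left.trans inf_le_left) X.F_anti

theorem decW_baseChange_eq_iSup (X : MixedHodgeDGA A) (n : ℕ) (m : ℤ) :
    (X.decW n m).baseChange ℂ = ⨆ j : ℤ, ⨆ _ : j ≤ m, X.deligne n j :=
  filtration_eq_iSup (X.opposedFiltrations n).mono
    (OpposedFiltrations.deligneWeight_le (F := X.F) (G := fun q => conjSubmodule (X.F q)))
    (X.opposedFiltrations n).le_deligneWeight_sup (X.opposedFiltrations n).exists_bot m

theorem iSup_deligne {X : MixedHodgeDGA A} (hX : ∀ p, X.W p ≤ X.strictW p) :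
    ⨆ x : ℕ × ℤ, X.deligne x.1 x.2 = ⊤ := by
  rw [eq_top_iff, ← (DirectSum.IsInternal.baseChange (S := ℂ) X.gr X.isInternal).submodule_iSup_eq_top]
  refine iSup_le fun n => ?_
  rw [Submodule.baseChange_eq_span, Submodule.span_le]
  rintro _ ⟨x, hx, rfl⟩
  obtain ⟨p, hp⟩ := X.W_exhaustive x
  have hx' : (1 : ℂ) ⊗ₜ[ℚ] x ∈ (X.decW n (p + n)).baseChange ℂ := by
    refine Submodule.tmul_mem_baseChange_of_mem 1 ?_
    rw [FilteredDGA.decW_eq_of_W_le_strictW hX]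
    exact ⟨hx, by simpa using hp⟩
  rw [decW_baseChange_eq_iSup] at hx'
  exact (iSup₂_le fun j _ => le_iSup (fun x : ℕ × ℤ => X.deligne x.1 x.2) (n, j)) hx'

theorem isInternal_deligne {X : MixedHodgeDGA A} (hX : ∀ p, X.W p ≤ X.strictW p) :
    DirectSum.IsInternal (fun x : ℕ × ℤ => X.deligne x.1 x.2) := by
  refine DirectSum.isInternal_submodule_of_iSupIndep_of_iSup_eq_top
    (iSupIndep_prod X.deligne (G := fun n => (X.gr n).baseChange ℂ) (fun n m => ?_)
      (DirectSum.IsInternal.baseChange (S := ℂ) X.gr X.isInternal).submodule_iSupIndep fun n => ?_) (iSup_deligne hX)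
  · exact (OpposedFiltrations.deligneWeight_le m).trans
      (Submodule.baseChange_mono ℂ (inf_le_left.trans inf_le_left))
  · exact iSupIndep_of_disjoint_filtration (X.opposedFiltrations n).mono
      OpposedFiltrations.deligneWeight_le (X.opposedFiltrations n).disjoint_deligneWeight

/-- Compatibility of `d` with Dec W is built into the décalage: `j - n - 1 = j - (n + 1)`, and `d ∘
d = 0` gives the second condition. -/
theorem d_mem_deligne {X : MixedHodgeDGA A} {n : ℕ} {m : ℤ} {x : ℂ ⊗[ℚ] A}
    (hx : x ∈ X.deligne n m) : X.d.baseChange ℂ x ∈ X.deligne (n + 1) m := by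
  refine deligneWeight_map _ (fun j y hy => map_mem_baseChange (fun z hz => ?_) hy)
    (fun j y hy => X.F_d hy) (fun j y hy => ?_) hx
  · refine ⟨⟨X.d_mem hz.1.1, ?_⟩, by simp [X.d_d]⟩
    have := hz.2
    rw [SetLike.mem_coe, Submodule.mem_comap, sub_sub] at this
    exact_mod_cast this
  · rw [mem_conjSubmodule, complexConj_baseChange]
    exact X.F_d hy

theorem mul_mem_deligne {X : MixedHodgeDGA A} (hX : ∀ p, X.W p ≤ X.strictW p) {n n' : ℕ}
    {m m' : ℤ} {x y : ℂ ⊗[ℚ] A} (hx : x ∈ X.deligne n m) (hy : y ∈ X.deligne n' m') :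
    x * y ∈ X.deligne (n + n') (m + m') := by
  refine deligneWeight_mul (fun j l x hx y hy => mul_mem_baseChange (fun a ha b hb => ?_) hx hy)
    (X.opposedFiltrations _).mono (fun j l x hx y hy => X.F_mul hx hy)
    (fun j l x hx y hy => ?_) hx hy
  · rw [FilteredDGA.decW_eq_of_W_le_strictW hX] at ha hb ⊢
    refine ⟨X.mul_mem ha.1 hb.1, ?_⟩
    have := X.W_mul ha.2 hb.2
    rwa [sub_add_sub_comm, ← Nat.cast_add] at this
  · rw [mem_conjSubmodule, complexConj_mul]
    exact X.F_mul hx hy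

theorem IsRelativeMinimal.map_mem_deligne {X : MixedHodgeDGA A} {Y : MixedHodgeDGA B}
    {f : A →ₐ[ℚ] B} (h : X.IsRelativeMinimal Y f) {n : ℕ} {m : ℤ} {x : ℂ ⊗[ℚ] A}
    (hx : x ∈ X.deligne n m) : f.toLinearMap.baseChange ℂ x ∈ Y.deligne n m := by
  have hW : ∀ p, ∀ x ∈ X.W p, f x ∈ Y.W p := fun p x hx => by
    rw [h.W_eq] at hx
    exact hx
  have hF : ∀ p, ∀ x ∈ X.F p, f.toLinearMap.baseChange ℂ x ∈ Y.F p := fun p x hx => by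
    rw [h.F_eq] at hx
    exact hx
  refine deligneWeight_map _ (fun j y hy => map_mem_baseChange (fun z hz => ?_) hy) hF
    (fun j y hy => ?_) hx
  · refine ⟨⟨h.map_gr n z hz.1.1, hW _ z hz.1.2⟩, ?_⟩
    change Y.d (f z) ∈ Y.W _
    rw [← h.map_d]
    exact hW _ _ hz.2
  · rw [mem_conjSubmodule, complexConj_baseChange]
    exact hF _ _ hy

/-- `θ` acts as multiplication by `m` on the weight `m` part of Deligne's splitting. -/
def IsDeligneOperator (X : MixedHodgeDGA A) (θ : ℂ ⊗[ℚ] A →ₗ[ℂ] ℂ ⊗[ℚ] A) : Prop :=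
  ∀ (n : ℕ) (m : ℤ), ∀ x ∈ X.deligne n m, θ x = (m : ℂ) • x

theorem exists_isDeligneOperator {X : MixedHodgeDGA A} (hX : ∀ p, X.W p ≤ X.strictW p) :
    ∃ θ, X.IsDeligneOperator θ :=
  (exists_linearMap_smul _ (isInternal_deligne hX) fun x => (x.2 : ℂ)).imp
    fun _ h n m x hx => h (n, m) x hx

/-- A property of elements of `ℂ ⊗ A` that is closed under addition may be checked on Deligne's
splitting. -/
theorem deligne_induction {X : MixedHodgeDGA A} (hX : ∀ p, X.W p ≤ X.strictW p)
    {motive : ℂ ⊗[ℚ] A → Prop} (mem : ∀ n m, ∀ x ∈ X.deligne n m, motive x) (zero : motive 0)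
    (add : ∀ x y, motive x → motive y → motive (x + y)) (x : ℂ ⊗[ℚ] A) : motive x :=
  Submodule.iSup_induction _ (motive := motive) (iSup_deligne hX ▸ Submodule.mem_top : x ∈ _)
    (fun i x hx => mem i.1 i.2 x hx) zero add

namespace IsDeligneOperator

variable {X : MixedHodgeDGA A} {θ : ℂ ⊗[ℚ] A →ₗ[ℂ] ℂ ⊗[ℚ] A}

theorem map_d (h : X.IsDeligneOperator θ) (hX : ∀ p, X.W p ≤ X.strictW p) (x : ℂ ⊗[ℚ] A) :
    θ (X.d.baseChange ℂ x) = X.d.baseChange ℂ (θ x) := by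
  induction x using deligne_induction hX with
  | mem n m x hx => rw [h _ _ _ (d_mem_deligne hx), h _ _ _ hx, map_smul]
  | zero => simp
  | add x y hx hy => simp only [map_add, hx, hy]

theorem leibniz (h : X.IsDeligneOperator θ) (hX : ∀ p, X.W p ≤ X.strictW p) (x y : ℂ ⊗[ℚ] A) :
    θ (x * y) = θ x * y + x * θ y := by
  induction x using deligne_induction hX with
  | zero => simp
  | add x x' hx hx' =>
    simp only [map_add, hx, hx', add_mul]
    abel
  | mem n m x hx =>
    induction y using deligne_induction hX with
    | zero => simp
    | add y y' hy hy' =>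
      simp only [map_add, hy, hy', mul_add]
      abel
    | mem n' m' y hy =>
      rw [h _ _ _ (mul_mem_deligne hX hx hy), h _ _ _ hx, h _ _ _ hy, smul_mul_assoc,
        mul_smul_comm, ← add_smul]
      push_cast
      rfl

theorem sub_smul_mem (h : X.IsDeligneOperator θ) {n : ℕ} {m : ℤ} {x : ℂ ⊗[ℚ] A}
    (hx : x ∈ (X.decW n m).baseChange ℂ) :
    θ x - (m : ℂ) • x ∈ (X.decW n (m - 1)).baseChange ℂ := by
  rw [decW_baseChange_eq_iSup] at hx
  refine (iSup₂_le fun j hj y hy => ?_ : _ ≤ ((X.decW n (m - 1)).baseChange ℂ).comap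
    (θ - (m : ℂ) • LinearMap.id)) hx
  simp only [Submodule.mem_comap, LinearMap.sub_apply, LinearMap.smul_apply, LinearMap.id_apply]
  rw [h _ _ _ hy, ← sub_smul]
  rcases hj.eq_or_lt with rfl | hlt
  · simp
  · exact Submodule.smul_mem _ _ ((X.opposedFiltrations n).mono (show j ≤ m - 1 by omega)
      (OpposedFiltrations.deligneWeight_le j hy))

theorem map_comp {Y : MixedHodgeDGA B} {f : A →ₐ[ℚ] B} (hf : X.IsRelativeMinimal Y f)
    (h : X.IsDeligneOperator θ) {η : ℂ ⊗[ℚ] B →ₗ[ℂ] ℂ ⊗[ℚ] B} (hη : Y.IsDeligneOperator η)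
    (hX : ∀ p, X.W p ≤ X.strictW p) (x : ℂ ⊗[ℚ] A) :
    f.toLinearMap.baseChange ℂ (θ x) = η (f.toLinearMap.baseChange ℂ x) := by
  induction x using deligne_induction hX with
  | mem n m x hx => rw [hη _ _ _ (hf.map_mem_deligne hx), h _ _ _ hx, map_smul]
  | zero => simp
  | add x y hx hy => simp only [map_add, hx, hy]

end IsDeligneOperator

end MixedHodgeDGA

/-! ### Descent to the rational numbers -/

section Descent

/-- Any ℚ-linear splitting of ℚ ⊂ ℂ will do: multiplicativity of `r` is never needed, since the
conditions on θ are affine in θ. -/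
theorem exists_rational_retraction : ∃ r : ℂ →ₗ[ℚ] ℚ, r 1 = 1 := by
  obtain ⟨r, hr⟩ := (Algebra.linearMap ℚ ℂ).exists_leftInverse_of_injective
    (LinearMap.ker_eq_bot.2 (algebraMap ℚ ℂ).injective)
  exact ⟨r, by simpa using LinearMap.congr_fun hr 1⟩

variable {V V' : Type*} [AddCommGroup V] [Module ℚ V] [AddCommGroup V'] [Module ℚ V']

/-- The map `ℂ ⊗ V → V` induced by `r : ℂ → ℚ`. -/
noncomputable def retract (r : ℂ →ₗ[ℚ] ℚ) (V : Type*) [AddCommGroup V] [Module ℚ V] :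
    ℂ ⊗[ℚ] V →ₗ[ℚ] V :=
  (TensorProduct.lid ℚ V).toLinearMap ∘ₗ LinearMap.rTensor V r

/-- The rational operator obtained from a complex one by means of `r : ℂ → ℚ`. -/
noncomputable def descend (r : ℂ →ₗ[ℚ] ℚ) (θ : ℂ ⊗[ℚ] V →ₗ[ℂ] ℂ ⊗[ℚ] V) : V →ₗ[ℚ] V :=
  retract r V ∘ₗ θ.restrictScalars ℚ ∘ₗ TensorProduct.mk ℚ ℂ V 1

variable (r : ℂ →ₗ[ℚ] ℚ)

@[simp]
theorem retract_tmul (c : ℂ) (v : V) : retract r V (c ⊗ₜ v) = r c • v := by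
  simp [retract]

@[simp]
theorem descend_apply (θ : ℂ ⊗[ℚ] V →ₗ[ℂ] ℂ ⊗[ℚ] V) (v : V) :
    descend r θ v = retract r V (θ (1 ⊗ₜ v)) :=
  rfl

theorem retract_baseChange (g : V →ₗ[ℚ] V') (x : ℂ ⊗[ℚ] V) :
    retract r V' (g.baseChange ℂ x) = g (retract r V x) := by
  induction x with
  | zero => simp
  | tmul c v => simp
  | add x y hx hy => simp only [map_add, hx, hy]

theorem retract_mem {S : Submodule ℚ V} {x : ℂ ⊗[ℚ] V} (hx : x ∈ S.baseChange ℂ) :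
    retract r V x ∈ S := by
  obtain ⟨y, rfl⟩ := hx
  rw [retract_baseChange]
  exact Subtype.property _

variable {A : Type*} [Ring A] [Algebra ℚ A]

theorem retract_mul_tmul (x : ℂ ⊗[ℚ] A) (a : A) :
    retract r A (x * 1 ⊗ₜ a) = retract r A x * a := by
  induction x with
  | zero => simp
  | tmul c v => simp
  | add x y hx hy => simp only [map_add, add_mul, hx, hy]

theorem retract_tmul_mul (x : ℂ ⊗[ℚ] A) (a : A) :
    retract r A (1 ⊗ₜ a * x) = a * retract r A x := by
  induction x with
  | zero => simp
  | tmul c v => simp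
  | add x y hx hy => simp only [map_add, mul_add, hx, hy]

end Descent

/-! ### The rational weight derivation. -/

namespace MixedHodgeDGA

variable {A B : Type*} [Ring A] [Algebra ℚ A] [Ring B] [Algebra ℚ B]

theorem IsDeligneOperator.isWeightDerivation {X : MixedHodgeDGA A}
    {θ : ℂ ⊗[ℚ] A →ₗ[ℂ] ℂ ⊗[ℚ] A} (h : X.IsDeligneOperator θ)
    (hX : ∀ p, X.W p ≤ X.strictW p) {r : ℂ →ₗ[ℚ] ℚ} (hr : r 1 = 1) :
    X.toFilteredDGA.IsWeightDerivation (descend r θ) where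
  map_d x := by
    rw [descend_apply, descend_apply, ← retract_baseChange, ← h.map_d hX, LinearMap.baseChange_tmul]
  leibniz x y := by
    have e : (1 : ℂ) ⊗ₜ[ℚ] (x * y) = 1 ⊗ₜ x * 1 ⊗ₜ y := by simp
    simp only [descend_apply]
    rw [e, h.leibniz hX, map_add, retract_mul_tmul, retract_tmul_mul]
  sub_smul_mem n m x hx := by
    rw [← FilteredDGA.decW_eq_of_W_le_strictW hX] at hx ⊢
    have := retract_mem r (h.sub_smul_mem (Submodule.tmul_mem_baseChange_of_mem 1 hx))
    convert this using 1
    have e : (m : ℂ) • (1 : ℂ) ⊗ₜ[ℚ] x = (1 : ℂ) ⊗ₜ[ℚ] ((m : ℚ) • x) := by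
      rw [TensorProduct.smul_tmul', ← TensorProduct.smul_tmul]
      congr 1
    -- The normalisation `r 1 = 1` preserves the scalar `m` of the graded action.
    rw [map_sub, e, retract_tmul, hr, one_smul, descend_apply]

end MixedHodgeDGA

theorem mainTheorem6 {M M' : Type*} [Ring M] [Algebra ℚ M] [Ring M'] [Algebra ℚ M']
    (X : MixedHodgeDGA M) (Y : MixedHodgeDGA M') (f : M →ₐ[ℚ] M')
    (hX : X.IsMinimal) (hf : X.IsRelativeMinimal Y f)
    (hXfin : X.FiniteType) (hYfin : Y.FiniteType) :
    X.toFilteredDGA.AdmitsSplitting Y.toFilteredDGA f 1 := by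
  have hXW := hX.W_le_strictW
  have hYW := hf.W_le_strictW hXW
  -- The same `r` serves for both algebras, so the descended operators are still intertwined by `f`.
  obtain ⟨r, hr⟩ := exists_rational_retraction
  obtain ⟨θ, hθ⟩ := MixedHodgeDGA.exists_isDeligneOperator hXW
  obtain ⟨η, hη⟩ := MixedHodgeDGA.exists_isDeligneOperator hYW
  refine FilteredDGA.admitsSplitting_one_of_isWeightDerivation (hθ.isWeightDerivation hXW hr)
    (hη.isWeightDerivation hYW hr) hf.map_gr fun x => ?_
  have := retract_baseChange r f.toLinearMap (θ (1 ⊗ₜ x))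
  rw [hθ.map_comp hf hη hXW] at this
  simpa using this.symm
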